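/- Let $I=[a,b]$ and let $(f_\mu)_{\mu\in M}$, $M\subseteq\mathbb R$, be a family of unimodal maps $f_\mu:I\to I$, jointly continuous in $(\mu,x)$: each $f_\mu$ is differentiable on $I$ and is strictly monotone, in opposite senses, on the two sides of its critical point $C_\mu\in(a,b)$, which is a maximum for every $\mu$ or a minimum for every $\mu$. Suppose the family undergoes a period doubling cascade: there are parameters $\nu_0<\nu_1<\nu_2<\cdots$ and, for every $p\ge 0$, a continuous branch $x_p:(\nu_p,\nu_{p+1}]\to I$ (with $(\nu_p,\nu_{p+1}]\subseteq M$) such that $x_p(\mu)$ is a periodic point of $f_\mu$ of least period $2^p$, whose orbit is attracting (multiplier of absolute value less than $1$) for $\mu<\nu_{p+1}$ and has multiplier $-1$ at $\mu=\nu_{p+1}$, and the next branch is born there: $x_{p+1}(\mu)\to x_p(\nu_{p+1})$ as $\mu\downarrow\nu_{p+1}$. The $2^p$-periodic orbit of the cascade is superstable at a parameter $s\in(\nu_p,\nu_{p+1})$ if the orbit of $x_p(s)$ under $f_s$ contains the critical point $C_s$. If the $q$-periodic orbit of the critical point $C$ of $f$ is superstable, let $C^*_{(1,q)},\dots,C^*_{(q,q)}$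 be the points of $\{C,f(C),\dots,f^{q-1}(C)\}$ listed in descending order if $f$ has a maximum at $C$ and in ascending order if $f$ has a minimum at $C$. The cardinal permutation of the orbit is the permutation $\sigma_q=(\sigma_{(1,q)},\dots,\sigma_{(q,q)})$ of $1,\dots,q$ with $f^{\sigma_{(i,q)}}(C)=C^*_{(i,q)}$ for $i=1,\dots,q$. For a finite sequence put $R(a_1,\dots,a_n;\alpha)=(a_1,\dots,a_n,a_n+\alpha,\dots,a_1+\alpha)$. **Theorem.** Let $p\ge 0$, let $\sigma_{2^p}$ be the cardinal permutation of the $2^p$-periodic superstable orbit of the cascade, and consider the $2^{p+1}$-periodic superstable orbit of the cascade (at any parameters where the respective orbits are superstable). Then the cardinal permutation of the latter is $$\sigma_{2^{p+1}}=R\bigl(2\sigma_{(1,2^p)}-1,\dots,2\sigma_{(2^p,2^p)}-1;\,1\bigr)=\bigl(2\sigma_{(1,2^p)}-1,\dots,2\sigma_{(2^p,2^p)}-1,\,2\sigma_{(2^p,2^p)},\dots,2\sigma_{(1,2^p)}\bigr),$$ that is, $f^{\sigma_{(i,2^{p+1})}}(C)=C^*_{(i,2^{p+1})}$ for $i=1,\dots,2^{p+1}$,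 and it is the only permutation of $1,\dots,2^{p+1}$ with this property. -/

import Mathlib

open Set Filter Topology

/-- The kind of turning point of a unimodal map. -/
inductive ExtremumKind where
  | maximum
  | minimum

/-- `g` is a unimodal self-map of `[a, b]` with critical point `c ∈ (a, b)`: it is differentiable
on `[a, b]` and strictly monotone on either side of its only turning point `c`, which is a maximum
or a minimum according to `e`. -/
structure IsUnimodal (e : ExtremumKind) (a b c : ℝ) (g : ℝ → ℝ) : Prop where
  critical_mem : c ∈ Ioo a b
  mapsTo : MapsTo g (Icc a b) (Icc a b)
  differentiableOn : DifferentiableOn ℝ g (Icc a b)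
  monotone_pieces :
    match e with
    | .maximum => StrictMonoOn g (Icc a c) ∧ StrictAntiOn g (Icc c b)
    | .minimum => StrictAntiOn g (Icc a c) ∧ StrictMonoOn g (Icc c b)

/-- A continuous family `f μ`, `μ ∈ M`, of unimodal self-maps of `[a, b]`; the critical point
`c μ` may move with the parameter. -/
structure IsUnimodalFamily (e : ExtremumKind) (a b : ℝ) (M : Set ℝ) (c : ℝ → ℝ)
    (f : ℝ → ℝ → ℝ) : Prop where
  continuousOn : ContinuousOn (fun z : ℝ × ℝ => f z.1 z.2) (M ×ˢ Icc a b)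
  unimodal : ∀ μ ∈ M, IsUnimodal e a b (c μ) (f μ)

/-- The multiplier `∏_{k < n} g'(g^k x)` of an `n`-periodic point `x` of a self-map `g` of
`[a, b]` (with one-sided derivatives at the endpoints). -/
noncomputable def orbitMultiplier (a b : ℝ) (g : ℝ → ℝ) (n : ℕ) (x : ℝ) : ℝ :=
  ∏ k ∈ Finset.range n, derivWithin g (Icc a b) (g^[k] x)

/-- The family `f μ` undergoes a period doubling cascade, with bifurcation parameters
`ν 0 < ν 1 < ν 2 < ⋯`. For `ν p < μ ≤ ν (p + 1)` the point `x p μ` is a point of least period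
`2 ^ p` depending continuously on `μ`; its orbit is attracting for `μ < ν (p + 1)`. At
`μ = ν (p + 1)` the multiplier of this orbit is `-1`, and the branch `x (p + 1)` of period
`2 ^ (p + 1)` is born there from the orbit of period `2 ^ p`. -/
structure IsPeriodDoublingCascade (a b : ℝ) (M : Set ℝ) (f : ℝ → ℝ → ℝ)
    (ν : ℕ → ℝ) (x : ℕ → ℝ → ℝ) : Prop where
  strictMono : StrictMono ν
  parameters_mem : ∀ p, Ioc (ν p) (ν (p + 1)) ⊆ M
  mem_interval : ∀ p, ∀ μ ∈ Ioc (ν p) (ν (p + 1)), x p μ ∈ Icc a b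
  minimalPeriod_eq : ∀ p, ∀ μ ∈ Ioc (ν p) (ν (p + 1)),
    Function.minimalPeriod (f μ) (x p μ) = 2 ^ p
  continuousOn : ∀ p, ContinuousOn (x p) (Ioc (ν p) (ν (p + 1)))
  attracting : ∀ p, ∀ μ ∈ Ioo (ν p) (ν (p + 1)),
    |orbitMultiplier a b (f μ) (2 ^ p) (x p μ)| < 1
  multiplier_eq : ∀ p,
    orbitMultiplier a b (f (ν (p + 1))) (2 ^ p) (x p (ν (p + 1))) = -1
  born : ∀ p, Tendsto (x (p + 1)) (𝓝[>] (ν (p + 1))) (𝓝 (x p (ν (p + 1))))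

/-- At the parameter `s` the `2 ^ p`-periodic orbit of the cascade is superstable: it contains the
critical point. -/
def IsSuperstableParameter (c : ℝ → ℝ) (f : ℝ → ℝ → ℝ) (ν : ℕ → ℝ) (x : ℕ → ℝ → ℝ)
    (p : ℕ) (s : ℝ) : Prop :=
  s ∈ Ioo (ν p) (ν (p + 1)) ∧ ∃ k : ℕ, (f s)^[k] (x p s) = c s

/-- The list of cardinals `C*_(1,q), …, C*_(q,q)`: the points of the orbit
`{c, g c, …, g^(q-1) c}`, in descending order if `g` has a maximum at `c` and in ascending order
if `g` has a minimum at `c`. -/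
noncomputable def orbitCardinals (e : ExtremumKind) (g : ℝ → ℝ) (c : ℝ) (q : ℕ) : List ℝ :=
  match e with
  | .maximum => ((Finset.range q).image fun k => g^[k] c).sort (· ≥ ·)
  | .minimum => ((Finset.range q).image fun k => g^[k] c).sort (· ≤ ·)

/-- `σ = (σ_(1,q), …, σ_(q,q))` is the cardinal permutation of the orbit of `c`: a permutation of
`1, …, q` such that `g^σ_(i,q) c = C*_(i,q)` for each `i`. -/
def IsCardinalPermutation (e : ExtremumKind) (g : ℝ → ℝ) (c : ℝ) (q : ℕ) (σ : List ℕ) : Prop :=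
  σ.Perm (List.range' 1 q) ∧ σ.map (fun k => g^[k] c) = orbitCardinals e g c q

/-- The reflection `R(a₁, …, aₙ; α) = (a₁, …, aₙ, aₙ + α, …, a₁ + α)`. -/
def seqReflection {A : Type*} [Add A] (l : List A) (α : A) : List A :=
  l ++ l.reverse.map (· + α)

/-!
The orbits of the cascade are followed along each branch only through the order of their points.
On a branch the points move continuously without meeting, so this order is constant
(`IsPeriodDoublingCascade.iterate_lt_iff`), and at the bifurcation every point of the orbit of
period `2 ^ p` splits into the two points with times `k` and `k + 2 ^ p` of the new orbit, so that
points of different pairs inherit their order (`IsPeriodDoublingCascade.isDoubling_bifurcation`).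

Let time be counted so that the extremal point of the orbit has time `1`. The point of time `0` can
then play the role of the critical point: the map is monotone, in opposite senses, on the orbit
points on either side of it (`IsUnimodal.isUnimodalCycle_orbit`). At a superstable parameter it is
the critical point. Since this normalization depends only on the order, it is the same along a
branch and compatible with doubling, and a superstable orbit is ordered like the orbit at any other
parameter of its branch (`IsPeriodDoublingCascade.superstable_orbit`).

The theorem thus becomes a statement on sequences `W p` of period `2 ^ p`: the odd points of
`W (p + 1)` lie above its even points, and `W (p + 1) (2 * k - 1)` is ordered like `W p k`
(`IsReflectedDouble`); the even points, being images of odd ones on the decreasing side, are then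
ordered in the opposite way. This holds for all `p` by induction
(`IsUnimodalCycle.isReflectedDouble_succ`). For points of different pairs it is inherited from the
preceding stage. Within the pairs, one starts from the pair of the extremal point and counts how
often the order is reversed: from `k` to `k + 1` in the shorter cycle and from `2 * k - 1` to
`2 * k + 1` in the longer one the number of reversals has the same parity
(`IsUnimodalCycle.odd_pair_lt_iff`).
-/

/-! ### Cycles of unimodal type -/

/-- `w` enumerates, by time, a cycle of `n` points on which the dynamics `w k ↦ w (k + 1)` is
increasing to the left of `w 0` and decreasing to the right of `w 0`; time is counted so that
`w 1` is the largest point. The point `w 0` replaces the critical point, which need not belong to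
the cycle. -/
structure IsUnimodalCycle (n : ℕ) (w : ℕ → ℝ) : Prop where
  eq_iff : ∀ i j, w i = w j ↔ i ≡ j [MOD n]
  le_one : ∀ k, w k ≤ w 1
  anti : ∀ i j, w 0 ≤ w i → w i < w j → w (j + 1) < w (i + 1)
  mono : ∀ i j, w j ≤ w 0 → w i < w j → w (i + 1) < w (j + 1)

/-- Up to order, the cycle `w` arises from the `n`-cycle `v` by replacing each point `v k` by the
two points `w k`, `w (k + n)`: points from different pairs are ordered as in `v`. -/
def IsDoubling (n : ℕ) (v w : ℕ → ℝ) : Prop :=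
  ∀ i j, ¬ i ≡ j [MOD n] → (w i < w j ↔ v i < v j)

/-- The order form of the reflection formula: the odd points of `w` lie above the even ones and,
numbered by `k ↦ 2 * k - 1`, are ordered like the points of `v`. -/
def IsReflectedDouble (v w : ℕ → ℝ) : Prop :=
  (∀ i j, w (2 * i) < w (2 * j + 1)) ∧
    ∀ i j, w (2 * i + 1) < w (2 * j + 1) ↔ v (i + 1) < v (j + 1)

namespace IsUnimodalCycle

variable {n : ℕ} {u v w : ℕ → ℝ}

lemma anti_iff (hw : IsUnimodalCycle n w) {i j : ℕ} (hi : w 0 ≤ w i) (hj : w 0 ≤ w j) :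
    w (i + 1) < w (j + 1) ↔ w j < w i := by
  refine ⟨fun h => ?_, fun h => hw.anti j i hj h⟩
  rcases lt_trichotomy (w i) (w j) with h' | h' | h'
  · exact absurd h (hw.anti i j hi h').not_gt
  · have := (hw.eq_iff (i + 1) (j + 1)).2 (((hw.eq_iff i j).1 h').add_right 1)
    exact absurd h (by simp [this])
  · exact h'

lemma mono_iff (hw : IsUnimodalCycle n w) {i j : ℕ} (hi : w i ≤ w 0) (hj : w j ≤ w 0) :
    w (i + 1) < w (j + 1) ↔ w i < w j := by
  refine ⟨fun h => ?_, fun h => hw.mono i j hj h⟩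
  rcases lt_trichotomy (w i) (w j) with h' | h' | h'
  · exact h'
  · have := (hw.eq_iff (i + 1) (j + 1)).2 (((hw.eq_iff i j).1 h').add_right 1)
    exact absurd h (by simp [this])
  · exact absurd h (hw.mono j i hi h').not_gt

/-- The even points of a reflected double are ordered oppositely to `v`: they are the images of
the odd points, all of which lie on the decreasing side. -/
lemma even_lt_even_iff (hn : 0 < n) (hv : IsUnimodalCycle n v) (hw : IsUnimodalCycle (2 * n) w)
    (h : IsReflectedDouble v w) (i j : ℕ) : w (2 * i) < w (2 * j) ↔ v j < v i := by
  have key : ∀ i j, w (2 * i + 2) < w (2 * j + 2) ↔ v (j + 1) < v (i + 1) := fun i j => by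
    rw [← h.2 j i]
    exact hw.anti_iff (h.1 0 i).le (h.1 0 j).le
  obtain ⟨m, rfl⟩ : ∃ m, n = m + 1 := ⟨n - 1, by omega⟩
  have hv' : ∀ k, v (k + m + 1) = v k := fun k => (hv.eq_iff _ _).2 (by
    rw [add_assoc]; exact Nat.add_modEq_right)
  have hw' : ∀ k, w (2 * (k + m) + 2) = w (2 * k) := fun k => (hw.eq_iff _ _).2 (by
    rw [show 2 * (k + m) + 2 = 2 * k + 2 * (m + 1) by ring]; exact Nat.add_modEq_right)
  simpa only [hv', hw'] using key (i + m) (j + m)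

/-- A cycle of two points is the reflected double of a fixed point. -/
lemma isReflectedDouble_of_fixed (hv : IsUnimodalCycle 1 v) (hw : IsUnimodalCycle 2 w) :
    IsReflectedDouble v w := by
  have h0 : ∀ i, w (2 * i) = w 0 := fun i => (hw.eq_iff _ _).2 (by simp [Nat.ModEq])
  have h1 : ∀ i, w (2 * i + 1) = w 1 := fun i => (hw.eq_iff _ _).2 (by simp [Nat.ModEq])
  have hv1 : ∀ i, v (i + 1) = v 1 := fun i => (hv.eq_iff _ _).2 (Nat.modEq_one)
  refine ⟨fun i j => ?_, fun i j => ?_⟩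
  · rw [h0, h1]
    refine (hw.le_one 0).lt_of_ne fun h => ?_
    exact absurd ((hw.eq_iff _ _).1 h) (by decide)
  · simp [h1, hv1]

/-- The order within the pairs: two points of `u` with odd times `2 * i + 1`, `2 * j + 1` from the
same pair are ordered like the points `w (i + 1)`, `w (j + 1)` of the corresponding pair. Both
pairs with `i ≡ 0` contain the largest point. Passing from `i` to `i + 1` the order of the pair in
`w` is reversed exactly if `w (i + 1)` is on the decreasing side; in `u` it is reversed once at the
odd time, and a second time exactly if `u (2 * (i + 1))` is on the decreasing side, that is, if
`w (i + 1)` is not. -/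
lemma odd_pair_lt_iff (hv : IsUnimodalCycle n v)
    (hw : IsUnimodalCycle (2 * n) w) (hu : IsUnimodalCycle (2 * (2 * n)) u)
    (hvw : IsDoubling n v w) (hwu : IsDoubling (2 * n) w u)
    (h : IsReflectedDouble v w) (hodd : ∀ i j, u (2 * i) < u (2 * j + 1)) (r : ℕ) (hr : r < n) :
    ∀ i j, i ≡ r [MOD n] → j ≡ r [MOD n] →
      (u (2 * i + 1) < u (2 * j + 1) ↔ w (i + 1) < w (j + 1)) := by
  have hn : 0 < n := by omega
  have heq : ∀ i j, u (2 * i + 1) = u (2 * j + 1) ↔ w (i + 1) = w (j + 1) := fun i j => by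
    rw [hu.eq_iff, hw.eq_iff]
    constructor
    · intro h
      exact (Nat.ModEq.mul_left_cancel' two_ne_zero (Nat.ModEq.add_right_cancel' 1 h)).add_right 1
    · intro h
      exact (Nat.ModEq.mul_left' 2 (Nat.ModEq.add_right_cancel' 1 h)).add_right 1
  induction r with
  | zero =>
    intro i j hi hj
    -- `i` and `j` are multiples of `n`, hence each is `0` or `n` modulo `2 * n`.
    have hmod : ∀ i, i ≡ 0 [MOD n] → i ≡ 0 [MOD 2 * n] ∨ i ≡ n [MOD 2 * n] := by
      intro i hi
      obtain ⟨t, rfl⟩ := (Nat.modEq_zero_iff_dvd).1 hi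
      rcases Nat.even_or_odd' t with ⟨q, rfl | rfl⟩
      · left; exact (Nat.modEq_zero_iff_dvd).2 ⟨q, by ring⟩
      · right
        rw [show n * (2 * q + 1) = n + 2 * n * q by ring]
        simp [Nat.ModEq]
    have hw1 : ∀ i, i ≡ 0 [MOD 2 * n] → w (i + 1) = w (0 + 1) :=
      fun i hi => (hw.eq_iff _ _).2 (hi.add_right 1)
    have hlt : ∀ i j, j ≡ 0 [MOD 2 * n] →
        (u (2 * i + 1) < u (2 * j + 1) ↔ w (i + 1) < w (j + 1)) := fun i j hj => by
      have e1 := hw1 j hj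
      have e2 := (heq j 0).2 e1
      have e3 := heq i 0
      rw [e1, e2]
      simp only [mul_zero, zero_add] at e3 ⊢
      rw [(hu.le_one _).lt_iff_ne, (hw.le_one _).lt_iff_ne, Ne, Ne, e3]
    rcases hmod j hj with hj' | hj'
    · exact hlt i j hj'
    rcases hmod i hi with hi' | hi'
    · have e1 := hw1 i hi'
      have e2 := (heq i 0).2 e1
      rw [e1, e2]
      simp only [mul_zero, zero_add]
      exact iff_of_false (hu.le_one _).not_gt (hw.le_one _).not_gt
    · have e1 : w (i + 1) = w (j + 1) := (hw.eq_iff _ _).2 ((hi'.trans hj'.symm).add_right 1)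
      rw [(heq i j).2 e1, e1]
      simp
  | succ r ih =>
    have hpos : ∀ i, i ≡ r + 1 [MOD n] → ∃ i', i = i' + 1 ∧ i' ≡ r [MOD n] := by
      intro i hi
      rcases i with _ | i
      · exfalso
        have := Nat.ModEq.eq_of_lt_of_lt hi hn hr
        omega
      · exact ⟨i, rfl, Nat.ModEq.add_right_cancel' 1 hi⟩
    intro i j hi hj
    have hz : ∀ k, k ≡ r + 1 [MOD n] → ¬ k ≡ 0 [MOD n] := fun k hk hk0 => by
      have := Nat.ModEq.eq_of_lt_of_lt (hk.symm.trans hk0) hr hn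
      omega
    have hz2 : ∀ k, k ≡ r + 1 [MOD n] → ¬ 2 * k ≡ 0 [MOD 2 * n] := fun k hk hk0 =>
      hz k hk (Nat.ModEq.mul_left_cancel' two_ne_zero hk0)
    have hvij : v i = v j := (hv.eq_iff _ _).2 (hi.trans hj.symm)
    have hwgt : ∀ k, k ≡ r + 1 [MOD n] → (w 0 < w k ↔ v 0 < v k) := fun k hk =>
      hvw 0 k fun h => hz k hk h.symm
    have hwlt : ∀ k, k ≡ r + 1 [MOD n] → (w k < w 0 ↔ v k < v 0) := fun k hk =>
      hvw k 0 (hz k hk)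
    have hugt : ∀ k, k ≡ r + 1 [MOD n] → (u 0 < u (2 * k) ↔ v k < v 0) := fun k hk => by
      rw [hwu 0 (2 * k) fun h => hz2 k hk h.symm]
      exact even_lt_even_iff hn hv hw h 0 k
    have hult : ∀ k, k ≡ r + 1 [MOD n] → (u (2 * k) < u 0 ↔ v 0 < v k) := fun k hk => by
      rw [hwu (2 * k) 0 (hz2 k hk)]
      exact even_lt_even_iff hn hv hw h k 0
    obtain ⟨i', rfl, hi'⟩ := hpos i hi
    obtain ⟨j', rfl, hj'⟩ := hpos j hj
    have step : ∀ a b, u (2 * (a + 1)) < u (2 * (b + 1)) ↔ u (2 * b + 1) < u (2 * a + 1) :=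
      fun a b => hu.anti_iff (hodd 0 a).le (hodd 0 b).le
    rcases lt_trichotomy (v (i' + 1)) (v 0) with hlt | h0 | hgt
    · have hlt' := hvij ▸ hlt
      rw [hw.mono_iff ((hwlt _ hi).2 hlt).le ((hwlt _ hj).2 hlt').le,
        hu.anti_iff ((hugt _ hi).2 hlt).le ((hugt _ hj).2 hlt').le, step,
        ih (by omega) i' j' hi' hj']
    · exact absurd ((hv.eq_iff _ _).1 h0) (hz _ hi)
    · have hgt' := hvij ▸ hgt
      rw [hw.anti_iff ((hwgt _ hi).2 hgt).le ((hwgt _ hj).2 hgt').le,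
        hu.mono_iff ((hult _ hi).2 hgt).le ((hult _ hj).2 hgt').le, step,
        ih (by omega) j' i' hj' hi']

/-- The reflection property is inherited under doubling. -/
lemma isReflectedDouble_of_isDoubling (hn : 0 < n) (hv : IsUnimodalCycle n v)
    (hw : IsUnimodalCycle (2 * n) w) (hu : IsUnimodalCycle (2 * (2 * n)) u)
    (hvw : IsDoubling n v w) (hwu : IsDoubling (2 * n) w u) (h : IsReflectedDouble v w) :
    IsReflectedDouble w u := by
  have hodd : ∀ i j, u (2 * i) < u (2 * j + 1) := fun i j => by
    refine (hwu _ _ fun hij => ?_).2 (h.1 i j)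
    have := hij.of_mul_right n
    simp [Nat.ModEq] at this
  refine ⟨hodd, fun i j => ?_⟩
  by_cases hij : i ≡ j [MOD n]
  · exact odd_pair_lt_iff hv hw hu hvw hwu h hodd (j % n) (Nat.mod_lt _ hn) i j
      (hij.trans (Nat.mod_modEq j n).symm) (Nat.mod_modEq j n).symm
  · rw [hwu _ _ fun h' => hij ?_, h.2, hvw _ _ fun h' => hij ?_]
    · exact Nat.ModEq.add_right_cancel' 1 h'
    · exact Nat.ModEq.mul_left_cancel' two_ne_zero (Nat.ModEq.add_right_cancel' 1 h')

/-- In a sequence of successively doubled cycles starting at a fixed point, each cycle is the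
reflected double of the preceding one. -/
lemma isReflectedDouble_succ {W : ℕ → ℕ → ℝ} (hW : ∀ p, IsUnimodalCycle (2 ^ p) (W p))
    (hd : ∀ p, IsDoubling (2 ^ p) (W p) (W (p + 1))) (p : ℕ) :
    IsReflectedDouble (W p) (W (p + 1)) := by
  have hpow : ∀ p : ℕ, 2 ^ (p + 1) = 2 * 2 ^ p := fun p => pow_succ' 2 p
  induction p with
  | zero => exact isReflectedDouble_of_fixed (hW 0) (hW 1)
  | succ p ih =>
    refine isReflectedDouble_of_isDoubling (Nat.two_pow_pos p) (hW p) (hpow p ▸ hW (p + 1)) ?_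
      (hd p) (hpow p ▸ hd (p + 1)) ih
    rw [← hpow, ← hpow]
    exact hW (p + 2)

end IsUnimodalCycle

/-! ### Orbits of unimodal maps -/

/-- The factor `±1` by which values are multiplied to turn the extremum into a maximum. -/
def ExtremumKind.sign : ExtremumKind → ℝ
  | .maximum => 1
  | .minimum => -1

lemma ExtremumKind.sign_mul_inj (e : ExtremumKind) {s t : ℝ} :
    e.sign * s = e.sign * t ↔ s = t := by
  cases e <;> simp [ExtremumKind.sign]

/-- The points of a periodic orbit, indexed by time, coincide exactly modulo the period. -/
lemma iterate_eq_iff_modEq {g : ℝ → ℝ} {n : ℕ} {z : ℝ} (hn : 0 < n)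
    (hper : Function.minimalPeriod g z = n) (i j : ℕ) :
    g^[i] z = g^[j] z ↔ i ≡ j [MOD n] := by
  subst hper
  rw [← Function.iterate_mod_minimalPeriod_eq (n := i),
    ← Function.iterate_mod_minimalPeriod_eq (n := j),
    Function.iterate_eq_iterate_iff_of_lt_minimalPeriod (Nat.mod_lt _ hn) (Nat.mod_lt _ hn)]
  rfl

namespace IsUnimodal

variable {e : ExtremumKind} {a b c : ℝ} {g : ℝ → ℝ}

lemma anti_right (h : IsUnimodal e a b c g) {s t : ℝ} (hs : s ∈ Icc a b) (ht : t ∈ Icc a b)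
    (hcs : e.sign * c ≤ e.sign * s) (hst : e.sign * s < e.sign * t) :
    e.sign * g t < e.sign * g s := by
  obtain ⟨-, -, -, h⟩ := h
  cases e <;> simp only [ExtremumKind.sign, one_mul, neg_mul, neg_le_neg_iff, neg_lt_neg_iff]
    at hcs hst ⊢
  · exact h.2 ⟨hcs, hs.2⟩ ⟨hcs.trans hst.le, ht.2⟩ hst
  · exact h.1 ⟨ht.1, hst.le.trans hcs⟩ ⟨hs.1, hcs⟩ hst

lemma mono_left (h : IsUnimodal e a b c g) {s t : ℝ} (hs : s ∈ Icc a b) (ht : t ∈ Icc a b)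
    (htc : e.sign * t ≤ e.sign * c) (hst : e.sign * s < e.sign * t) :
    e.sign * g s < e.sign * g t := by
  obtain ⟨-, -, -, h⟩ := h
  cases e <;> simp only [ExtremumKind.sign, one_mul, neg_mul, neg_le_neg_iff, neg_lt_neg_iff]
    at htc hst ⊢
  · exact h.1 ⟨hs.1, hst.le.trans htc⟩ ⟨ht.1, htc⟩ hst
  · exact h.2 ⟨htc, ht.2⟩ ⟨htc.trans hst.le, hs.2⟩ hst

lemma le_critical_value (h : IsUnimodal e a b c g) {s : ℝ} (hs : s ∈ Icc a b) :
    e.sign * g s ≤ e.sign * g c := by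
  have hc : c ∈ Icc a b := Ioo_subset_Icc_self h.critical_mem
  rcases lt_trichotomy (e.sign * s) (e.sign * c) with h' | h' | h'
  · exact (h.mono_left hs hc le_rfl h').le
  · rw [e.sign_mul_inj.1 h']
  · exact (h.anti_right hc hs le_rfl h').le

/-- A periodic orbit of a unimodal map is a unimodal cycle if time is counted from the preimage
of its extremal point. A point of the orbit on the far side of that preimage is on the same side
of the critical point, since otherwise its image would be even more extremal. -/
lemma isUnimodalCycle_orbit (h : IsUnimodal e a b c g) {n m : ℕ} {z : ℝ} (hz : z ∈ Icc a b)
    (hn : 0 < n) (hper : Function.minimalPeriod g z = n)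
    (hm : ∀ k, e.sign * g^[k] z ≤ e.sign * g^[m + 1] z) :
    IsUnimodalCycle n (fun k => e.sign * g^[k + m] z) := by
  have hmem : ∀ k, g^[k] z ∈ Icc a b := fun k => h.mapsTo.iterate k hz
  have heq : ∀ i j, e.sign * g^[i] z = e.sign * g^[j] z ↔ i ≡ j [MOD n] := fun i j => by
    rw [e.sign_mul_inj, iterate_eq_iff_modEq hn hper]
  have hsucc : ∀ k, g^[k + 1 + m] z = g (g^[k + m] z) := fun k => by
    rw [add_right_comm, Function.iterate_succ_apply']
  have hm' : ∀ k, e.sign * g (g^[k] z) ≤ e.sign * g (g^[0 + m] z) := fun k => by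
    rw [← hsucc, ← Function.iterate_succ_apply' g, zero_add, add_comm 1]
    exact hm _
  have hext : ∀ i j, g^[i + m] z = g^[j + m] z ↔
      e.sign * g (g^[i + m] z) = e.sign * g (g^[j + m] z) := fun i j => by
    rw [← hsucc, ← hsucc, ← e.sign_mul_inj, heq, heq, add_right_comm i, add_right_comm j]
    exact ⟨fun h => h.add_right 1, fun h => Nat.ModEq.add_right_cancel' 1 h⟩
  refine ⟨fun i j => ?_, fun k => ?_, fun i j hi hij => ?_, fun i j hj hij => ?_⟩
  · rw [heq]
    exact ⟨fun h => Nat.ModEq.add_right_cancel' m h, fun h => h.add_right m⟩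
  · simpa only [add_comm 1 m] using hm (k + m)
  · simp only [hsucc] at hi hij ⊢
    by_cases hc : e.sign * c ≤ e.sign * g^[i + m] z
    · exact h.anti_right (hmem _) (hmem _) hc hij
    · have h0 : g^[i + m] z = g^[0 + m] z := by
        by_contra hne
        exact (h.mono_left (hmem _) (hmem _) (not_le.1 hc).le
          (hi.lt_of_ne fun h => hne (e.sign_mul_inj.1 h).symm)).not_ge (hm' _)
      rw [h0] at hij ⊢
      exact (hm' _).lt_of_ne fun h => hij.ne' (by rw [(hext _ _).2 h])
  · simp only [hsucc] at hj hij ⊢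
    by_cases hc : e.sign * g^[j + m] z ≤ e.sign * c
    · exact h.mono_left (hmem _) (hmem _) hc hij
    · have h0 : g^[j + m] z = g^[0 + m] z := by
        by_contra hne
        exact (h.anti_right (hmem _) (hmem _) (not_le.1 hc).le
          (hj.lt_of_ne fun h => hne (e.sign_mul_inj.1 h))).not_ge (hm' _)
      rw [h0] at hij ⊢
      exact (hm' _).lt_of_ne fun h => hij.ne (by rw [(hext _ _).2 h])

end IsUnimodal

/-- A periodic orbit has a largest point; it is attained at a positive time. -/
lemma exists_iterate_succ_max {g : ℝ → ℝ} {z : ℝ} (φ : ℝ → ℝ)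
    (hz : 0 < Function.minimalPeriod g z) :
    ∃ m, ∀ k, φ (g^[k] z) ≤ φ (g^[m + 1] z) := by
  set n := Function.minimalPeriod g z
  obtain ⟨m, -, hm⟩ := (Finset.range n).exists_max_image (fun k => φ (g^[k] z))
    ⟨0, Finset.mem_range.2 hz⟩
  refine ⟨m + n - 1, fun k => ?_⟩
  rw [Nat.sub_add_cancel (by omega), Function.iterate_add_minimalPeriod_eq,
    ← Function.iterate_mod_minimalPeriod_eq]
  exact hm _ (Finset.mem_range.2 (Nat.mod_lt _ hz))

/-! ### Order along the branches of the cascade -/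

namespace IsUnimodalFamily

variable {e : ExtremumKind} {a b : ℝ} {M : Set ℝ} {c : ℝ → ℝ} {f : ℝ → ℝ → ℝ}

lemma tendsto_iterate (hf : IsUnimodalFamily e a b M c f) {l : Filter ℝ} {y : ℝ → ℝ} {μ₀ y₀ : ℝ}
    (hμ₀ : μ₀ ∈ M) (hy₀ : y₀ ∈ Icc a b) (hl : Tendsto id l (𝓝 μ₀)) (hy : Tendsto y l (𝓝 y₀))
    (hM : ∀ᶠ μ in l, μ ∈ M ∧ y μ ∈ Icc a b) (k : ℕ) :
    Tendsto (fun μ => (f μ)^[k] (y μ)) l (𝓝 ((f μ₀)^[k] y₀)) := by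
  induction k with
  | zero => exact hy
  | succ k ih =>
    simp only [Function.iterate_succ_apply']
    have hc : ContinuousWithinAt (fun z : ℝ × ℝ => f z.1 z.2) (M ×ˢ Icc a b)
        (μ₀, (f μ₀)^[k] y₀) :=
      hf.continuousOn _ ⟨hμ₀, (hf.unimodal _ hμ₀).mapsTo.iterate k hy₀⟩
    refine Tendsto.comp (g := fun z : ℝ × ℝ => f z.1 z.2)
      (f := fun μ => (μ, (f μ)^[k] (y μ))) hc (tendsto_nhdsWithin_iff.2 ⟨?_, ?_⟩)
    · exact hl.prodMk_nhds ih
    · filter_upwards [hM] with μ hμ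
      exact ⟨hμ.1, (hf.unimodal _ hμ.1).mapsTo.iterate k hμ.2⟩

end IsUnimodalFamily

namespace IsPeriodDoublingCascade

variable {e : ExtremumKind} {a b : ℝ} {M : Set ℝ} {c : ℝ → ℝ} {f : ℝ → ℝ → ℝ}
  {ν : ℕ → ℝ} {x : ℕ → ℝ → ℝ}

lemma right_mem (hx : IsPeriodDoublingCascade a b M f ν x) (p : ℕ) :
    ν (p + 1) ∈ Ioc (ν p) (ν (p + 1)) :=
  right_mem_Ioc.2 (hx.strictMono p.lt_succ_self)

/-- The order of the points of the orbit does not change along a branch, because the points move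
continuously without meeting. -/
lemma iterate_lt_iff (hf : IsUnimodalFamily e a b M c f)
    (hx : IsPeriodDoublingCascade a b M f ν x) {p : ℕ} {μ μ' : ℝ}
    (hμ : μ ∈ Ioc (ν p) (ν (p + 1))) (hμ' : μ' ∈ Ioc (ν p) (ν (p + 1))) (i j : ℕ) :
    e.sign * (f μ)^[i] (x p μ) < e.sign * (f μ)^[j] (x p μ) ↔
      e.sign * (f μ')^[i] (x p μ') < e.sign * (f μ')^[j] (x p μ') := by
  have heq : ∀ μ ∈ Ioc (ν p) (ν (p + 1)),
      (e.sign * (f μ)^[i] (x p μ) = e.sign * (f μ)^[j] (x p μ) ↔ i ≡ j [MOD 2 ^ p]) := by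
    intro μ hμ
    rw [e.sign_mul_inj, iterate_eq_iff_modEq (Nat.two_pow_pos p) (hx.minimalPeriod_eq p μ hμ)]
  have hcont : ∀ k, ContinuousOn (fun μ => e.sign * (f μ)^[k] (x p μ)) (Ioc (ν p) (ν (p + 1))) :=
    fun k μ hμ => Tendsto.const_mul _ <| hf.tendsto_iterate (hx.parameters_mem p hμ)
      (hx.mem_interval p μ hμ) (tendsto_id'.2 nhdsWithin_le_nhds) (hx.continuousOn p μ hμ)
      (eventually_mem_nhdsWithin.mono fun μ hμ =>
        ⟨hx.parameters_mem p hμ, hx.mem_interval p μ hμ⟩) k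
  by_cases hij : i ≡ j [MOD 2 ^ p]
  · rw [(heq μ hμ).2 hij, (heq μ' hμ').2 hij]
    simp
  have key : ∀ μ ∈ Ioc (ν p) (ν (p + 1)), ∀ μ' ∈ Ioc (ν p) (ν (p + 1)),
      e.sign * (f μ)^[i] (x p μ) < e.sign * (f μ)^[j] (x p μ) →
        e.sign * (f μ')^[i] (x p μ') < e.sign * (f μ')^[j] (x p μ') := by
    intro μ hμ μ' hμ' hlt
    by_contra hge
    obtain ⟨t, ht, hteq⟩ := isPreconnected_Ioc.intermediate_value₂ hμ hμ' (hcont i) (hcont j)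
      hlt.le (not_lt.1 hge)
    exact hij ((heq t ht).1 hteq)
  exact ⟨key μ hμ μ' hμ', key μ' hμ' μ hμ⟩

/-- At the bifurcation the points of the new orbit split off in pairs from those of the old one,
so that points of different pairs keep the order of the old points; by `iterate_lt_iff` this
persists along the new branch. -/
lemma isDoubling_bifurcation (hf : IsUnimodalFamily e a b M c f)
    (hx : IsPeriodDoublingCascade a b M f ν x) (p : ℕ) :
    IsDoubling (2 ^ p) (fun k => e.sign * (f (ν (p + 1)))^[k] (x p (ν (p + 1))))
      (fun k => e.sign * (f (ν (p + 2)))^[k] (x (p + 1) (ν (p + 2)))) := by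
  have hlim : ∀ k, Tendsto (fun μ => e.sign * (f μ)^[k] (x (p + 1) μ)) (𝓝[>] (ν (p + 1)))
      (𝓝 (e.sign * (f (ν (p + 1)))^[k] (x p (ν (p + 1))))) := fun k => by
    refine Tendsto.const_mul _ (hf.tendsto_iterate (hx.parameters_mem p (hx.right_mem p))
      (hx.mem_interval p _ (hx.right_mem p)) (tendsto_id'.2 nhdsWithin_le_nhds) (hx.born p) ?_ k)
    filter_upwards [Ioc_mem_nhdsGT (hx.strictMono (p + 1).lt_succ_self)] with μ hμ
    exact ⟨hx.parameters_mem _ hμ, hx.mem_interval _ μ hμ⟩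
  have key : ∀ i j,
      e.sign * (f (ν (p + 1)))^[i] (x p (ν (p + 1))) <
        e.sign * (f (ν (p + 1)))^[j] (x p (ν (p + 1))) →
      e.sign * (f (ν (p + 2)))^[i] (x (p + 1) (ν (p + 2))) <
        e.sign * (f (ν (p + 2)))^[j] (x (p + 1) (ν (p + 2))) := by
    intro i j h
    have hev := Ioc_mem_nhdsGT (hx.strictMono (p + 1).lt_succ_self)
    obtain ⟨μ, hμ, hlt⟩ :=
      (Filter.Eventually.and hev ((hlim i).eventually_lt (hlim j) h)).exists
    exact (hx.iterate_lt_iff hf hμ (hx.right_mem (p + 1)) i j).1 hlt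
  intro i j hij
  refine ⟨fun h => ?_, key i j⟩
  by_contra hge
  refine (key j i ((not_lt.1 hge).lt_of_ne fun heq => hij ?_)).not_gt h
  rw [e.sign_mul_inj, iterate_eq_iff_modEq (Nat.two_pow_pos p)
    (hx.minimalPeriod_eq p _ (hx.right_mem p))] at heq
  exact heq.symm

/-- Shift time on the orbit at the end `ν (p + 1)` of each branch by `m p`, so that its extremal
point has time `1`. The orbits then form a sequence of unimodal cycles, each a doubling of the
preceding one. -/
lemma exists_unimodalCycles (hf : IsUnimodalFamily e a b M c f)
    (hx : IsPeriodDoublingCascade a b M f ν x) :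
    ∃ m : ℕ → ℕ,
      (∀ p k, e.sign * (f (ν (p + 1)))^[k] (x p (ν (p + 1))) ≤
        e.sign * (f (ν (p + 1)))^[m p + 1] (x p (ν (p + 1)))) ∧
      (∀ p, IsUnimodalCycle (2 ^ p)
        (fun k => e.sign * (f (ν (p + 1)))^[k + m p] (x p (ν (p + 1))))) ∧
      ∀ p, IsDoubling (2 ^ p) (fun k => e.sign * (f (ν (p + 1)))^[k + m p] (x p (ν (p + 1))))
        (fun k => e.sign * (f (ν (p + 2)))^[k + m (p + 1)] (x (p + 1) (ν (p + 2)))) := by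
  have hmem := hx.right_mem
  have hper := fun p => hx.minimalPeriod_eq p _ (hmem p)
  choose m hm using fun p => exists_iterate_succ_max (e.sign * ·)
    (show 0 < Function.minimalPeriod (f (ν (p + 1))) (x p (ν (p + 1))) from
      hper p ▸ Nat.two_pow_pos p)
  refine ⟨m, hm, fun p => (hf.unimodal _ (hx.parameters_mem p (hmem p))).isUnimodalCycle_orbit
    (hx.mem_interval p _ (hmem p)) (Nat.two_pow_pos p) (hper p) (hm p), fun p i j hij => ?_⟩
  have hd := hx.isDoubling_bifurcation hf p
  -- The extremal point of the new orbit belongs to the pair born from the extremal point of the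
  -- old one.
  have hmm : m (p + 1) ≡ m p [MOD 2 ^ p] := by
    by_contra hne
    have hne' : ¬ m p + 1 ≡ m (p + 1) + 1 [MOD 2 ^ p] :=
      fun h => hne (Nat.ModEq.add_right_cancel' 1 h).symm
    have hne2 : ¬ m (p + 1) + 1 ≡ m p + 1 [MOD 2 ^ p] := fun h => hne' h.symm
    have h1 := (hm p (m (p + 1) + 1)).lt_of_ne fun h => hne2 <| by
      rwa [e.sign_mul_inj, iterate_eq_iff_modEq (Nat.two_pow_pos p) (hper p)] at h
    exact ((hd _ _ hne2).2 h1).not_ge (hm (p + 1) _)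
  have hshift : ∀ k, (f (ν (p + 1)))^[k + m (p + 1)] (x p (ν (p + 1))) =
      (f (ν (p + 1)))^[k + m p] (x p (ν (p + 1))) := fun k =>
    (iterate_eq_iff_modEq (Nat.two_pow_pos p) (hper p) _ _).2 (hmm.add_left k)
  have := hd (i + m (p + 1)) (j + m (p + 1)) fun h => hij (Nat.ModEq.add_right_cancel' _ h)
  simpa only [hshift] using this

/-- At a superstable parameter the critical point takes the place of the preimage of the extremal
point: its orbit is a cycle, ordered like the cycle at the end of the branch. -/
lemma superstable_orbit (hf : IsUnimodalFamily e a b M c f)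
    (hx : IsPeriodDoublingCascade a b M f ν x) {p : ℕ} {s : ℝ}
    (hs : IsSuperstableParameter c f ν x p s) {m : ℕ}
    (hm : ∀ k, e.sign * (f (ν (p + 1)))^[k] (x p (ν (p + 1))) ≤
        e.sign * (f (ν (p + 1)))^[m + 1] (x p (ν (p + 1)))) :
    Function.minimalPeriod (f s) (c s) = 2 ^ p ∧
      ∀ i j, e.sign * (f s)^[i] (c s) < e.sign * (f s)^[j] (c s) ↔
        e.sign * (f (ν (p + 1)))^[i + m] (x p (ν (p + 1))) <
          e.sign * (f (ν (p + 1)))^[j + m] (x p (ν (p + 1))) := by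
  obtain ⟨hs, k₀, hk₀⟩ := hs
  have hs' := Ioo_subset_Ioc_self hs
  have hpos := Nat.two_pow_pos p
  have hper := hx.minimalPeriod_eq p s hs'
  have hperν := hx.minimalPeriod_eq p _ (hx.right_mem p)
  have hlt := hx.iterate_lt_iff hf hs' (hx.right_mem p)
  have hu := hf.unimodal s (hx.parameters_mem p hs')
  have hmem : ∀ k, (f s)^[k] (x p s) ∈ Icc a b :=
    fun k => hu.mapsTo.iterate k (hx.mem_interval p s hs')
  have hiter : ∀ i, (f s)^[i] (c s) = (f s)^[i + k₀] (x p s) := fun i => by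
    rw [Function.iterate_add_apply, hk₀]
  have hshift : k₀ ≡ m [MOD 2 ^ p] := by
    refine Nat.ModEq.add_right_cancel' 1 ((iterate_eq_iff_modEq hpos hper _ _).1 ?_)
    rw [← e.sign_mul_inj]
    refine le_antisymm ?_ ?_
    · exact not_lt.1 fun h => ((hlt _ _).1 h).not_ge (hm _)
    · rw [Function.iterate_succ_apply', Function.iterate_succ_apply', hk₀]
      exact hu.le_critical_value (hmem m)
  refine ⟨?_, fun i j => ?_⟩
  · rw [← hk₀, Function.minimalPeriod_apply_iterate _ k₀, hper]
    exact Function.minimalPeriod_pos_iff_mem_periodicPts.1 (hper ▸ hpos)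
  · rw [hiter, hiter, hlt, (iterate_eq_iff_modEq hpos hperν _ _).2 (hshift.add_left i),
      (iterate_eq_iff_modEq hpos hperν _ _).2 (hshift.add_left j)]

end IsPeriodDoublingCascade

/-! ### Cardinal permutations -/

/-- A permutation of `1, …, q` is a cardinal permutation exactly if the values of the iterates,
with the sign adapted to the extremum, decrease along it. -/
lemma isCardinalPermutation_iff {e : ExtremumKind} {g : ℝ → ℝ} {c : ℝ} {q : ℕ} (hq : 0 < q)
    (hper : Function.minimalPeriod g c = q) (σ : List ℕ) :
    IsCardinalPermutation e g c q σ ↔ σ.Perm (List.range' 1 q) ∧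
      σ.Pairwise fun i j => e.sign * g^[j] c < e.sign * g^[i] c := by
  refine and_congr_right fun hσ => ?_
  have hmem : ∀ k, k ∈ σ ↔ 1 ≤ k ∧ k < 1 + q := fun k => by rw [hσ.mem_iff, List.mem_range'_1]
  have hinj := iterate_eq_iff_modEq hq hper
  have hne : σ.Pairwise fun i j => g^[i] c ≠ g^[j] c := by
    refine (hσ.nodup_iff.2 List.nodup_range').imp_of_mem fun {i j} hi hj hij h => hij ?_
    rw [hmem] at hi hj
    -- Times run from `1` to `q`; lowering them by `1` makes them residues modulo `q`.
    have := Nat.ModEq.add_right_cancel' 1 (a := i - 1) (b := j - 1)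
      (by simpa [Nat.sub_add_cancel hi.1, Nat.sub_add_cancel hj.1] using (hinj i j).1 h)
    have := Nat.ModEq.eq_of_lt_of_lt this (by omega) (by omega)
    omega
  have hnodup : (σ.map fun k => g^[k] c).Nodup := List.pairwise_map.2 hne
  have himage : (Finset.range q).image (fun k => g^[k] c) =
      (σ.map fun k => g^[k] c).toFinset := by
    ext y
    simp only [Finset.mem_image, Finset.mem_range, List.mem_toFinset, List.mem_map, hmem]
    constructor
    · rintro ⟨k, hk, rfl⟩
      rcases k with _ | k
      · exact ⟨q, by omega, (hinj _ _).2 (by simp [Nat.ModEq])⟩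
      · exact ⟨k + 1, by omega, rfl⟩
    · rintro ⟨k, hk, rfl⟩
      exact ⟨k % q, Nat.mod_lt _ hq, (hinj _ _).2 (Nat.mod_modEq k q)⟩
  have hstrict : (σ.Pairwise fun i j => e.sign * g^[j] c < e.sign * g^[i] c) ↔
      σ.Pairwise fun i j => e.sign * g^[j] c ≤ e.sign * g^[i] c := by
    refine ⟨fun h => h.imp le_of_lt, fun h => (h.and hne).imp fun h => ?_⟩
    exact h.1.lt_of_ne fun h' => h.2 (e.sign_mul_inj.1 h').symm
  rw [hstrict]
  cases e <;> simp only [orbitCardinals, himage, ExtremumKind.sign, one_mul, neg_mul,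
    neg_le_neg_iff] <;> rw [eq_comm, List.toFinset_sort _ hnodup, List.pairwise_map]

/-- Doubling the numbers `1, …, n`, in any order, and adding their predecessors gives the numbers
`1, …, 2 * n`. -/
lemma perm_odd_append_even {n : ℕ} {σ : List ℕ} (hσ : σ.Perm (List.range' 1 n)) :
    ((σ.map fun k => 2 * k - 1) ++ (σ.map fun k => 2 * k).reverse).Perm
      (List.range' 1 (2 * n)) := by
  have hmem : ∀ k, k ∈ σ ↔ 1 ≤ k ∧ k < 1 + n := fun k => by rw [hσ.mem_iff, List.mem_range'_1]
  have hnd : σ.Nodup := hσ.nodup_iff.2 List.nodup_range'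
  refine (List.perm_ext_iff_of_nodup ?_ List.nodup_range').2 fun k => ?_
  · refine List.Nodup.append (hnd.map_on fun i hi j hj h => ?_)
      (List.nodup_reverse.2 (hnd.map fun i j h => ?_)) fun k hk hk' => ?_
    · rw [hmem] at hi hj
      omega
    · simpa using h
    · simp only [List.mem_reverse, List.mem_map, hmem] at hk hk'
      omega
  · simp only [List.mem_append, List.mem_reverse, List.mem_map, hmem, List.mem_range'_1]
    constructor
    · rintro (⟨t, ht, rfl⟩ | ⟨t, ht, rfl⟩) <;> omega
    · intro hk
      rcases Nat.even_or_odd' k with ⟨t, rfl | rfl⟩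
      · exact Or.inr ⟨t, by omega, rfl⟩
      · exact Or.inl ⟨t + 1, by omega, by omega⟩

/-- If `w` is a reflected double of `v`, a list along which `v` decreases is turned by the
reflection formula into one along which `w` decreases. -/
lemma IsReflectedDouble.pairwise {n : ℕ} {v w : ℕ → ℝ} (hn : 0 < n) (hv : IsUnimodalCycle n v)
    (hw : IsUnimodalCycle (2 * n) w) (h : IsReflectedDouble v w) {σ : List ℕ}
    (hpos : ∀ k ∈ σ, 1 ≤ k) (hσ : σ.Pairwise fun i j => v j < v i) :
    ((σ.map fun k => 2 * k - 1) ++ (σ.map fun k => 2 * k).reverse).Pairwise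
      fun i j => w j < w i := by
  have hodd : ∀ k, 1 ≤ k → 2 * k - 1 = 2 * (k - 1) + 1 := by omega
  refine List.pairwise_append.2 ⟨?_, ?_, ?_⟩
  · refine List.pairwise_map.2 (hσ.imp_of_mem fun {i j} hi hj hij => ?_)
    rw [hodd i (hpos i hi), hodd j (hpos j hj), h.2, Nat.sub_add_cancel (hpos i hi),
      Nat.sub_add_cancel (hpos j hj)]
    exact hij
  · refine List.pairwise_reverse.2 (List.pairwise_map.2 (hσ.imp fun hij => ?_))
    exact (hv.even_lt_even_iff hn hw h _ _).2 hij
  · intro i hi j hj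
    simp only [List.mem_reverse, List.mem_map] at hi hj
    obtain ⟨k, hk, rfl⟩ := hi
    obtain ⟨l, -, rfl⟩ := hj
    rw [hodd k (hpos k hk)]
    exact h.1 _ _

lemma seqReflection_odd_eq {σ : List ℕ} (hpos : ∀ k ∈ σ, 1 ≤ k) :
    seqReflection (σ.map fun k => 2 * k - 1) 1 =
      (σ.map fun k => 2 * k - 1) ++ (σ.map fun k => 2 * k).reverse := by
  rw [seqReflection, ← List.map_reverse, ← List.map_reverse, List.map_map]
  congr 1
  refine List.map_congr_left fun k hk => ?_
  have := hpos k (List.mem_reverse.1 hk)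
  simp only [Function.comp_apply]
  omega

theorem mainTheorem2 (e : ExtremumKind) (a b : ℝ) (M : Set ℝ) (c : ℝ → ℝ) (f : ℝ → ℝ → ℝ)
    (hf : IsUnimodalFamily e a b M c f)
    (ν : ℕ → ℝ) (x : ℕ → ℝ → ℝ) (hcascade : IsPeriodDoublingCascade a b M f ν x)
    (p : ℕ) (s s' : ℝ)
    (hs : IsSuperstableParameter c f ν x p s)
    (hs' : IsSuperstableParameter c f ν x (p + 1) s')
    (σ : List ℕ) (hσ : IsCardinalPermutation e (f s) (c s) (2 ^ p) σ) :
    IsCardinalPermutation e (f s') (c s') (2 ^ (p + 1))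
        (seqReflection (σ.map fun k => 2 * k - 1) 1) ∧
      (∀ τ : List ℕ, IsCardinalPermutation e (f s') (c s') (2 ^ (p + 1)) τ →
        τ = seqReflection (σ.map fun k => 2 * k - 1) 1) ∧
      seqReflection (σ.map fun k => 2 * k - 1) 1 =
        (σ.map fun k => 2 * k - 1) ++ (σ.map fun k => 2 * k).reverse := by
  obtain ⟨m, hm, hcyc, hdbl⟩ := hcascade.exists_unimodalCycles hf
  obtain ⟨hper, hlt⟩ := hcascade.superstable_orbit hf hs (hm p)
  obtain ⟨hper', hlt'⟩ := hcascade.superstable_orbit hf hs' (hm (p + 1))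
  rw [isCardinalPermutation_iff (Nat.two_pow_pos p) hper] at hσ
  obtain ⟨hperm, hsort⟩ := hσ
  have hpos : ∀ k ∈ σ, 1 ≤ k := fun k hk => (List.mem_range'_1.1 (hperm.mem_iff.1 hk)).1
  have hpow : 2 ^ (p + 1) = 2 * 2 ^ p := pow_succ' 2 p
  have hrefl := IsUnimodalCycle.isReflectedDouble_succ hcyc hdbl p
  rw [seqReflection_odd_eq hpos]
  simp only [isCardinalPermutation_iff (Nat.two_pow_pos (p + 1)) hper']
  simp only [hlt] at hsort
  simp only [hlt']
  have hperm' := perm_odd_append_even hperm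
  have hsort' := hrefl.pairwise (Nat.two_pow_pos p) (hcyc p) (hpow ▸ hcyc (p + 1)) hpos hsort
  rw [← hpow] at hperm'
  refine ⟨⟨hperm', hsort'⟩, fun τ hτ => ?_, trivial⟩
  exact List.Perm.eq_of_pairwise (fun i j _ _ h h' => (lt_asymm h h').elim) hτ.2 hsort'
    (hτ.1.trans hperm'.symm)
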